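/- Let $\mu$ be a positive Borel measure on $\mathbb{R}$ with $\int |x|^m\,d\mu(x)<\infty$ for every integer $m\ge 0$, whose support $\Sigma$ is an infinite set. Assume that $\Sigma$ is bounded above, let $\eta$ be the right end point of its convex hull $C_0(\Sigma)$ (the left end point $\xi$ may be finite or $-\infty$), and let $a\ge\eta$ be a real number. For $N\ge 0$ put $d\mu_N=d\mu+N\delta_a$, and put $d\mu^{**}=(x-a)^2\,d\mu$. Let $\{p_m\}$, $\{p_m^{N}\}$ and $\{p_m^{**}\}$ be the sequences of monic orthogonal polynomials (the $m$-th polynomial having degree $m$) with respect to $\mu$, $\mu_N$ and $\mu^{**}$. Fix $n\ge 1$ and let $$B_n=K_{n-1}(a,a)=\sum_{j=0}^{n-1}\frac{p_j(a)^2}{\int p_j^2\,d\mu}.$$ Then $p_n$, $p_n^{N}$ and $p_{n-1}^{**}$ have only real and simple zeros. Denote them in increasing order by $x_{n,1}<\dots<x_{n,n}$, $x^N_{n,1}<\dots<x^N_{n,n}$ and $x^{**}_{n-1,1}<\dots<x^{**}_{n-1,n-1}$, respectively. 1. For every $N>0$, $$x_{n,1}<x_{n,1}^{N}<x_{n-1,1}^{**}<x_{n,2}<x_{n,2}^{N}<\cdots<x_{n,n-1}<x_{n,n-1}^{N}<x_{n-1,n-1}^{**}<x_{n,n}<x_{n,n}^{N}<a.$$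 2. For each $k=1,\dots,n$, $x_{n,k}^{N}$ is a strictly increasing function of $N\in[0,\infty)$. 3. For each $k=1,\dots,n-1$, $$\lim_{N\to\infty}x_{n,n}^{N}=a,\qquad \lim_{N\to\infty}x_{n,k}^{N}=x_{n-1,k}^{**}.$$ 4. For each $k=1,\dots,n-1$, $$\lim_{N\to\infty}N\,[a-x_{n,n}^{N}]=\frac{p_n(a)}{B_n\,p_{n-1}^{**}(a)},\qquad \lim_{N\to\infty}N\,[x_{n-1,k}^{**}-x_{n,k}^{N}]=\frac{p_n(x_{n-1,k}^{**})}{B_n\,(x_{n-1,k}^{**}-a)\,(p_{n-1}^{**})'(x_{n-1,k}^{**})}.$$ (For $n=1$ there are no zeros $x^{**}_{0,k}$, and the assertions about $k\le n-1$ are void.) -/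

import Mathlib

/-- The bilinear form `⟨p, q⟩_μ = ∫ p(x) q(x) dμ(x)` on real polynomials. -/
noncomputable def polyInner (μ : MeasureTheory.Measure ℝ) (p q : Polynomial ℝ) : ℝ :=
  ∫ x, p.eval x * q.eval x ∂μ

/-- A sequence of monic polynomials, the `n`-th one of degree exactly `n`, that are pairwise
orthogonal for `μ` (a standard monic orthogonal polynomial sequence). -/
structure IsMOPS (μ : MeasureTheory.Measure ℝ) (p : ℕ → Polynomial ℝ) : Prop where
  monic : ∀ n, (p n).Monic
  natDegree : ∀ n, (p n).natDegree = n
  orthogonal : ∀ m n, m ≠ n → polyInner μ (p n) (p m) = 0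

/-- The monic orthogonal polynomials of `μ`, built from the monomials by the Gram-Schmidt
procedure. By `isMOPS_mops` and `IsMOPS.eq_mops` below this is the unique standard MOPS of `μ`
when `μ` has all its moments finite and infinite support. -/
noncomputable def mops (μ : MeasureTheory.Measure ℝ) (n : ℕ) : Polynomial ℝ :=
  Polynomial.X ^ n - ∑ j : Fin n,
    Polynomial.C (polyInner μ (Polynomial.X ^ n) (mops μ j) / polyInner μ (mops μ j) (mops μ j))
      * mops μ j
termination_by n
decreasing_by exact j.2

/-- The kernel polynomial `K_n(x, y) = ∑_{j=0}^{n} p_j(y) p_j(x) / ‖p_j‖_μ²` of `μ`. -/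
noncomputable def kernelPoly (μ : MeasureTheory.Measure ℝ) (n : ℕ) (x y : ℝ) : ℝ :=
  ∑ j ∈ Finset.range (n + 1),
    (mops μ j).eval y * (mops μ j).eval x / polyInner μ (mops μ j) (mops μ j)

/-- The iterated Christoffel perturbation `dμ** = (x - a)² dμ`. -/
noncomputable def iteratedChristoffel (μ : MeasureTheory.Measure ℝ) (a : ℝ) :
    MeasureTheory.Measure ℝ :=
  μ.withDensity (fun x => ENNReal.ofReal ((x - a) ^ 2))

/-- The Uvarov perturbation `dμ_N = dμ + N δ_a`, for a mass `N ≥ 0`. -/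
noncomputable def uvarov (μ : MeasureTheory.Measure ℝ) (a N : ℝ) : MeasureTheory.Measure ℝ :=
  μ + ENNReal.ofReal N • MeasureTheory.Measure.dirac a

/-- `x 1 < x 2 < ⋯ < x m` are exactly the zeros of `p`, whose degree is `m`. In particular `p`
has `m` real zeros and all of them are simple. Values of `x` outside `{1, …, m}` play no role. -/
structure ListsZeros (p : Polynomial ℝ) (m : ℕ) (x : ℕ → ℝ) : Prop where
  natDegree : p.natDegree = m
  strictMonoOn : StrictMonoOn x (Set.Icc 1 m)
  isRoot_iff : ∀ t : ℝ, p.IsRoot t ↔ ∃ k ∈ Set.Icc 1 m, x k = t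

/-! The measures considered determine a unique standard MOPS. -/

theorem integrable_polyEval {μ : MeasureTheory.Measure ℝ}
    (hmom : ∀ n : ℕ, MeasureTheory.Integrable (fun x : ℝ => |x| ^ n) μ) (p : Polynomial ℝ) :
    MeasureTheory.Integrable (fun x => p.eval x) μ := by
  simp only [Polynomial.eval_eq_sum_range]
  refine MeasureTheory.integrable_finsetSum _ fun i _ => MeasureTheory.Integrable.const_mul ?_ _
  refine (hmom i).mono' (by fun_prop) (Filter.Eventually.of_forall fun x => ?_)
  simp

theorem polyInner_self_pos {μ : MeasureTheory.Measure ℝ}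
    (hmom : ∀ n : ℕ, MeasureTheory.Integrable (fun x : ℝ => |x| ^ n) μ)
    (hinf : μ.support.Infinite) {p : Polynomial ℝ} (hp : p ≠ 0) : 0 < polyInner μ p p := by
  have hint : MeasureTheory.Integrable (fun x => p.eval x * p.eval x) μ := by
    simpa using integrable_polyEval hmom (p * p)
  unfold polyInner
  rw [MeasureTheory.integral_pos_iff_support_of_nonneg (fun x => mul_self_nonneg _) hint]
  obtain ⟨t, ht, htp⟩ := hinf.exists_notMem_finset p.roots.toFinset
  rw [MeasureTheory.Measure.mem_support_iff_forall] at ht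
  have hopen : IsOpen (Function.support fun x => p.eval x * p.eval x) :=
    (p.continuous.mul p.continuous).isOpen_support
  refine ht _ (hopen.mem_nhds ?_)
  simpa [hp] using htp

theorem polyInner_add_left {μ : MeasureTheory.Measure ℝ}
    (hmom : ∀ n : ℕ, MeasureTheory.Integrable (fun x : ℝ => |x| ^ n) μ)
    (p q r : Polynomial ℝ) : polyInner μ (p + q) r = polyInner μ p r + polyInner μ q r := by
  unfold polyInner
  rw [← MeasureTheory.integral_add (by simpa using integrable_polyEval hmom (p * r))
    (by simpa using integrable_polyEval hmom (q * r))]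
  simp [add_mul]

theorem polyInner_C_mul_left (μ : MeasureTheory.Measure ℝ) (c : ℝ) (p q : Polynomial ℝ) :
    polyInner μ (Polynomial.C c * p) q = c * polyInner μ p q := by
  unfold polyInner
  rw [← MeasureTheory.integral_const_mul]
  simp [mul_assoc]

theorem polyInner_comm (μ : MeasureTheory.Measure ℝ) (p q : Polynomial ℝ) :
    polyInner μ p q = polyInner μ q p := by
  simp [polyInner, mul_comm]

theorem polyInner_sub_left {μ : MeasureTheory.Measure ℝ}
    (hmom : ∀ n : ℕ, MeasureTheory.Integrable (fun x : ℝ => |x| ^ n) μ)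
    (p q r : Polynomial ℝ) : polyInner μ (p - q) r = polyInner μ p r - polyInner μ q r := by
  have h := polyInner_add_left hmom (p - q) q r
  rw [sub_add_cancel] at h
  linarith

theorem polyInner_sum_left {μ : MeasureTheory.Measure ℝ}
    (hmom : ∀ n : ℕ, MeasureTheory.Integrable (fun x : ℝ => |x| ^ n) μ)
    {ι : Type} (s : Finset ι) (f : ι → Polynomial ℝ) (r : Polynomial ℝ) :
    polyInner μ (∑ i ∈ s, f i) r = ∑ i ∈ s, polyInner μ (f i) r := by
  classical
  induction s using Finset.induction_on with
  | empty => simp [polyInner]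
  | insert i s hi ih => rw [Finset.sum_insert hi, Finset.sum_insert hi,
      polyInner_add_left hmom, ih]

theorem mops_monic_natDegree (μ : MeasureTheory.Measure ℝ) (n : ℕ) :
    (mops μ n).Monic ∧ (mops μ n).natDegree = n := by
  induction n using Nat.strong_induction_on with
  | _ n ih =>
    have hdeg : (∑ j : Fin n, Polynomial.C (polyInner μ (Polynomial.X ^ n) (mops μ j) /
        polyInner μ (mops μ j) (mops μ j)) * mops μ j).degree < (n : WithBot ℕ) := by
      refine (Polynomial.degree_sum_le _ _).trans_lt ?_
      refine (Finset.sup_lt_iff (WithBot.bot_lt_coe n)).mpr fun j _ => ?_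
      refine Polynomial.degree_le_natDegree.trans_lt (lt_of_le_of_lt
        (WithBot.coe_le_coe.mpr (Polynomial.natDegree_C_mul_le _ _)) ?_)
      rw [(ih j j.2).2]
      exact_mod_cast j.2
    rw [mops]
    exact ⟨Polynomial.monic_X_pow_sub hdeg, Polynomial.natDegree_eq_of_degree_eq_some (by
      rw [Polynomial.degree_sub_eq_left_of_degree_lt (by simpa using hdeg)]; simp)⟩

theorem isMOPS_mops {μ : MeasureTheory.Measure ℝ}
    (hmom : ∀ n : ℕ, MeasureTheory.Integrable (fun x : ℝ => |x| ^ n) μ)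
    (hinf : μ.support.Infinite) : IsMOPS μ (mops μ) := by
  have key : ∀ n, ∀ m < n, polyInner μ (mops μ n) (mops μ m) = 0 := by
    intro n
    induction n using Nat.strong_induction_on with
    | _ n ih =>
      intro m hm
      rw [mops.eq_def μ n, polyInner_sub_left hmom, polyInner_sum_left hmom,
        Finset.sum_eq_single (⟨m, hm⟩ : Fin n)]
      · have := polyInner_self_pos hmom hinf (mops_monic_natDegree μ m).1.ne_zero
        rw [polyInner_C_mul_left]
        field_simp
        simp
      · intro j _ hj
        rw [polyInner_C_mul_left]
        have hne : (j : ℕ) ≠ m := fun h => hj (Fin.ext h)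
        rcases lt_or_gt_of_ne hne with h | h
        · rw [polyInner_comm μ (mops μ j) (mops μ m), ih m hm j h, mul_zero]
        · rw [ih j j.2 m h, mul_zero]
      · simp
  refine ⟨fun n => (mops_monic_natDegree μ n).1, fun n => (mops_monic_natDegree μ n).2, ?_⟩
  intro m n hmn
  rcases lt_or_gt_of_ne hmn with h | h
  · exact key n m h
  · rw [polyInner_comm]; exact key m n h

theorem IsMOPS.orthogonal_of_degree_lt {μ : MeasureTheory.Measure ℝ}
    (hmom : ∀ n : ℕ, MeasureTheory.Integrable (fun x : ℝ => |x| ^ n) μ)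
    {p : ℕ → Polynomial ℝ} (hp : IsMOPS μ p) (n d : ℕ) (hd : d ≤ n) (q : Polynomial ℝ)
    (hq : q.degree < (d : WithBot ℕ)) : polyInner μ q (p n) = 0 := by
  induction d generalizing q with
  | zero =>
    have : q = 0 := by simpa using hq
    simp [this, polyInner]
  | succ d ih =>
    have hle : q.degree ≤ (d : WithBot ℕ) := by
      rw [Polynomial.degree_le_iff_coeff_zero]
      intro m hm
      have hm' : d < m := by exact_mod_cast hm
      exact Polynomial.coeff_eq_zero_of_degree_lt (hq.trans_le (by exact_mod_cast hm'))
    have h1 : (q - Polynomial.C (q.coeff d) * p d).degree < (d : WithBot ℕ) := by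
      rw [Polynomial.degree_lt_iff_coeff_zero]
      intro m hm
      rcases hm.eq_or_lt with rfl | hm
      · have : (p d).coeff d = 1 := by simpa [hp.natDegree d] using (hp.monic d).coeff_natDegree
        simp [this]
      · have h2 : q.coeff m = 0 :=
          Polynomial.coeff_eq_zero_of_degree_lt (hle.trans_lt (by exact_mod_cast hm))
        have h3 : (p d).coeff m = 0 :=
          Polynomial.coeff_eq_zero_of_natDegree_lt (by rw [hp.natDegree d]; exact hm)
        simp [h2, h3]
    have h4 := ih (by omega) _ h1
    rw [polyInner_sub_left hmom, polyInner_C_mul_left,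
      hp.orthogonal n d (by omega)] at h4
    linarith

theorem IsMOPS.eq_mops {μ : MeasureTheory.Measure ℝ}
    (hmom : ∀ n : ℕ, MeasureTheory.Integrable (fun x : ℝ => |x| ^ n) μ)
    (hinf : μ.support.Infinite) {p : ℕ → Polynomial ℝ} (hp : IsMOPS μ p) : p = mops μ := by
  funext n
  have hm := isMOPS_mops hmom hinf
  have hdeg : (p n - mops μ n).degree < (n : WithBot ℕ) := by
    have h := Polynomial.degree_sub_lt_left (p := p n) (q := mops μ n) (by
      rw [Polynomial.degree_eq_natDegree (hp.monic n).ne_zero,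
        Polynomial.degree_eq_natDegree (hm.monic n).ne_zero, hp.natDegree, hm.natDegree])
      (hp.monic n).ne_zero (by rw [(hp.monic n).leadingCoeff, (hm.monic n).leadingCoeff])
    rwa [Polynomial.degree_eq_natDegree (hp.monic n).ne_zero, hp.natDegree] at h
  have h1 := hp.orthogonal_of_degree_lt hmom n n le_rfl _ hdeg
  have h2 := hm.orthogonal_of_degree_lt hmom n n le_rfl _ hdeg
  by_contra hne
  have h3 := polyInner_self_pos hmom hinf (sub_ne_zero.mpr hne)
  rw [polyInner_sub_left hmom, polyInner_comm μ (p n), polyInner_comm μ (mops μ n), h1, h2] at h3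
  simp at h3

/-!
Write `p = mops μ n`, `K = K_{n-1}(·, a)`, `B = K(a)` and `q = (X - a) p**` with `p**` the
polynomial of degree `n - 1` for `(x - a)² dμ`. By the reproducing property of `K` one has
`q = p - (p(a) / B) K` (`X_sub_C_mul_mops_iteratedChristoffel`) and
`(1 + B N) p^N = p + B N q` (`C_mul_mops_uvarov`). So the zeros of `p^N` are those of the pencil
`p + c q` with `c = B N`, and everything follows from the behaviour of such a pencil once `p` and
`q` are known to have strictly interlacing zeros `x 1 < y 1 < ⋯ < x n < y n = a`.

Interlacing (`exists_interlacing_iteratedChristoffel`): the zeros of `p` are real, simple and less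
than `a`, since otherwise `p = s r` with `s` of constant sign on the support and `r` of lower
degree, so that `∫ p r = ∫ s r² ≠ 0`. At a zero `t` of `p = (X - t) r` one has
`r(a) r(t) = K(t) ∫ r²` (`eval_mul_eval_kernelPolynomial`). Hence `K(t)` has the sign of `p'(t)`,
and `q(t)` the opposite one, so `q` has a zero in each gap between the zeros of `p`, besides `a`.

The pencil (namespace `Interlacing`): for `c ≥ 0` the polynomial `p + c q` has exactly one zero
`z k` in each `[x k, y k)`, and a point `t` there satisfies `t < z k` as soon as `p(t) + c q(t)`
has the sign of `q(t)` (`Interlacing.lt_pencil_zero`). Taking for `t` the point `x k`, the zero for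
a smaller `c`, or a fixed point while `c → ∞` gives in turn the strict inequality `x k < z k`, the
monotonicity in `c`, and the limit `z k → y k`. Writing `q = (X - y k) r`, the equation for `z k`
reads `c (y k - z k) = p(z k) / r(z k)`, which gives the speed of convergence.
-/

open Polynomial MeasureTheory Set Filter Topology

/-! ### Polynomials with prescribed ordered zeros -/

theorem ListsZeros.isRoot {p : ℝ[X]} {n : ℕ} {z : ℕ → ℝ} (h : ListsZeros p n z) {k : ℕ}
    (hk : k ∈ Icc 1 n) : p.eval (z k) = 0 :=
  (h.isRoot_iff _).2 ⟨k, hk, rfl⟩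

theorem Polynomial.Monic.eq_prod_X_sub_C {p : ℝ[X]} {n : ℕ} {z : ℕ → ℝ} (hm : p.Monic)
    (hd : p.natDegree = n) (hz : StrictMonoOn z (Icc 1 n))
    (hr : ∀ k ∈ Icc 1 n, p.eval (z k) = 0) :
    p = ∏ k ∈ Finset.Icc 1 n, (X - C (z k)) := by
  have hprod : (∏ k ∈ Finset.Icc 1 n, (X - C (z k))).Monic :=
    monic_prod_of_monic _ _ fun k _ => monic_X_sub_C _
  symm
  refine eq_of_monic_of_dvd_of_natDegree_le hprod hm
    (Finset.prod_dvd_of_coprime ?_ fun k hk => ?_) ?_ |>.symm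
  · intro i hi j hj hij
    refine isCoprime_X_sub_C_of_isUnit_sub (sub_ne_zero.2 fun h => hij ?_).isUnit
    exact hz.injOn (by simpa using hi) (by simpa using hj) h
  · exact dvd_iff_isRoot.2 (hr k (by simpa using hk))
  · rw [natDegree_prod_of_monic _ _ fun k _ => monic_X_sub_C _]
    simp [hd]

theorem Polynomial.Monic.listsZeros {p : ℝ[X]} {n : ℕ} {z : ℕ → ℝ} (hm : p.Monic)
    (hd : p.natDegree = n) (hz : StrictMonoOn z (Icc 1 n))
    (hr : ∀ k ∈ Icc 1 n, p.eval (z k) = 0) : ListsZeros p n z := by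
  refine ⟨hd, hz, fun t => ⟨fun ht => ?_, ?_⟩⟩
  · rw [hm.eq_prod_X_sub_C hd hz hr, IsRoot.def, eval_prod, Finset.prod_eq_zero_iff] at ht
    obtain ⟨k, hk, h⟩ := ht
    exact ⟨k, by simpa using hk, by simpa [sub_eq_zero, eq_comm] using h⟩
  · rintro ⟨k, hk, rfl⟩
    exact hr k hk

theorem ListsZeros.eq_prod {p : ℝ[X]} {n : ℕ} {z : ℕ → ℝ} (h : ListsZeros p n z)
    (hm : p.Monic) : p = ∏ k ∈ Finset.Icc 1 n, (X - C (z k)) :=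
  hm.eq_prod_X_sub_C h.natDegree h.strictMonoOn fun _ hk => h.isRoot hk

theorem neg_one_pow_card_mul_prod_pos {ι : Type*} [DecidableEq ι] {s u : Finset ι} {z : ι → ℝ}
    {t : ℝ} (hu : u ⊆ s) (hgt : ∀ j ∈ u, t < z j) (hlt : ∀ j ∈ s \ u, z j < t) :
    0 < (-1) ^ u.card * ∏ j ∈ s, (t - z j) := by
  have h : (-1) ^ u.card * ∏ j ∈ s, (t - z j) =
      (∏ j ∈ s \ u, (t - z j)) * ∏ j ∈ u, (z j - t) := by
    rw [← Finset.prod_sdiff hu, ← Finset.prod_const, mul_left_comm, ← Finset.prod_mul_distrib]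
    simp
  rw [h]
  exact mul_pos (Finset.prod_pos fun j hj => sub_pos.2 (hlt j hj))
    (Finset.prod_pos fun j hj => sub_pos.2 (hgt j hj))

/-- The sign of a monic polynomial to the right of exactly `m` of its `n` zeros. -/
theorem ListsZeros.neg_one_pow_mul_eval_pos {p : ℝ[X]} {n : ℕ} {z : ℕ → ℝ}
    (h : ListsZeros p n z) (hm : p.Monic) {m : ℕ} (hmn : m ≤ n) {t : ℝ}
    (hlt : 1 ≤ m → z m < t) (hgt : m < n → t < z (m + 1)) :
    0 < (-1) ^ (n - m) * p.eval t := by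
  have hmono := h.strictMonoOn.monotoneOn
  have := neg_one_pow_card_mul_prod_pos (s := Finset.Icc 1 n) (u := Finset.Icc (m + 1) n)
    (z := z) (t := t) (Finset.Icc_subset_Icc_left (by omega))
    (fun j hj => ?_) (fun j hj => ?_)
  · rw [h.eq_prod hm, eval_prod]
    simpa using this
  · rw [Finset.mem_Icc] at hj
    exact (hgt (by omega)).trans_le (hmono ⟨by omega, by omega⟩ ⟨by omega, hj.2⟩ hj.1)
  · simp only [Finset.mem_sdiff, Finset.mem_Icc] at hj
    exact (hmono ⟨by omega, by omega⟩ ⟨by omega, by omega⟩ (by omega)).trans_lt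
      (hlt (by omega))

/-- Deleting the `k`-th zero: the cofactor of `X - z k` is nonzero at `z k`, with the sign
determined by the `n - k` zeros to its right. -/
theorem ListsZeros.exists_cofactor {p : ℝ[X]} {n : ℕ} {z : ℕ → ℝ}
    (h : ListsZeros p n z) (hm : p.Monic) {k : ℕ} (hk : k ∈ Icc 1 n) :
    ∃ r : ℝ[X], p = (X - C (z k)) * r ∧ 0 < (-1) ^ (n - k) * r.eval (z k) := by
  refine ⟨∏ j ∈ (Finset.Icc 1 n).erase k, (X - C (z j)), ?_, ?_⟩
  · rw [Finset.mul_prod_erase _ (fun j => X - C (z j)) (by simpa using hk)]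
    exact h.eq_prod hm
  · obtain ⟨hk1, hkn⟩ := hk
    have := neg_one_pow_card_mul_prod_pos (s := (Finset.Icc 1 n).erase k)
      (u := Finset.Ioc k n) (z := z) (t := z k)
      (fun j hj => ?_) (fun j hj => ?_) (fun j hj => ?_)
    · simpa [eval_prod] using this
    · simp only [Finset.mem_erase, Finset.mem_Ioc, Finset.mem_Icc] at hj ⊢
      omega
    · rw [Finset.mem_Ioc] at hj
      exact h.strictMonoOn ⟨hk1, hkn⟩ ⟨by omega, hj.2⟩ hj.1
    · simp only [Finset.mem_sdiff, Finset.mem_erase, Finset.mem_Ioc, Finset.mem_Icc] at hj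
      exact h.strictMonoOn ⟨by omega, by omega⟩ ⟨hk1, hkn⟩ (by omega)

/-! ### The pencil of two interlacing polynomials -/

/-- The monic polynomials `p` and `q` of degree `n` have real simple zeros `x k` and `y k` with
`x 1 < y 1 < x 2 < y 2 < ⋯ < x n < y n`. -/
structure Interlacing (p q : ℝ[X]) (n : ℕ) (x y : ℕ → ℝ) : Prop where
  left_monic : p.Monic
  right_monic : q.Monic
  left : ListsZeros p n x
  right : ListsZeros q n y
  lt : ∀ k ∈ Icc 1 n, x k < y k
  lt_succ : ∀ k ∈ Icc 1 (n - 1), y k < x (k + 1)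

namespace Interlacing

variable {p q : ℝ[X]} {n : ℕ} {x y : ℕ → ℝ}

theorem lt_of_lt (H : Interlacing p q n x y) {j k : ℕ} (hj : 1 ≤ j) (hjk : j < k)
    (hk : k ≤ n) : y j < x k := by
  have h := H.lt_succ (k - 1) ⟨by omega, by omega⟩
  rw [Nat.sub_add_cancel (by omega)] at h
  exact (H.right.strictMonoOn.monotoneOn ⟨hj, by omega⟩ ⟨by omega, by omega⟩
    (by omega)).trans_lt h

theorem left_sign (H : Interlacing p q n x y) {k : ℕ} (hk : k ∈ Icc 1 n) {t : ℝ}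
    (ht : t ∈ Ioc (x k) (y k)) : 0 < (-1) ^ (n - k) * p.eval t :=
  H.left.neg_one_pow_mul_eval_pos H.left_monic hk.2 (fun _ => ht.1)
    fun h => ht.2.trans_lt (H.lt_succ k ⟨hk.1, by omega⟩)

theorem right_sign (H : Interlacing p q n x y) {k : ℕ} (hk : k ∈ Icc 1 n) {t : ℝ}
    (ht : t ∈ Ico (x k) (y k)) : (-1) ^ (n - k) * q.eval t < 0 := by
  obtain ⟨hk1, hkn⟩ := hk
  have h := H.right.neg_one_pow_mul_eval_pos H.right_monic (m := k - 1) (t := t) (by omega)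
    (fun h => (H.lt_of_lt h (by omega) hkn).trans_le ht.1)
    (fun _ => by rw [Nat.sub_add_cancel hk1]; exact ht.2)
  rw [show n - (k - 1) = n - k + 1 by omega, pow_succ] at h
  linarith

theorem exists_root_pencil (H : Interlacing p q n x y) {c : ℝ} {k : ℕ}
    (hk : k ∈ Icc 1 n) {t : ℝ} (ht : t ∈ Ico (x k) (y k))
    (hs : (-1) ^ (n - k) * (p + C c * q).eval t ≤ 0) :
    ∃ z ∈ Ico t (y k), (p + C c * q).eval z = 0 := by
  have hy : 0 < (-1) ^ (n - k) * (p + C c * q).eval (y k) := by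
    have := H.left_sign hk ⟨H.lt k hk, le_rfl⟩
    simpa [H.right.isRoot hk] using this
  obtain ⟨z, hz, hz0⟩ := intermediate_value_Icc ht.2.le
    (f := fun u => (-1) ^ (n - k) * (p + C c * q).eval u) (by fun_prop) ⟨hs, hy.le⟩
  have hz1 : (p + C c * q).eval z = 0 := by simpa using hz0
  refine ⟨z, ⟨hz.1, hz.2.lt_of_ne ?_⟩, hz1⟩
  rintro rfl
  simp [hz1] at hy

/-- For `c ≥ 0` the polynomial `p + c q` has a zero in every interval `[x k, y k)`. -/
theorem exists_pencil_zeros (H : Interlacing p q n x y) {c : ℝ} (hc : 0 ≤ c) :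
    ∃ z : ℕ → ℝ, ∀ k ∈ Icc 1 n, z k ∈ Ico (x k) (y k) ∧ (p + C c * q).eval (z k) = 0 := by
  have (k : ℕ) : ∃ z, k ∈ Icc 1 n → z ∈ Ico (x k) (y k) ∧ (p + C c * q).eval z = 0 := by
    by_cases hk : k ∈ Icc 1 n
    · obtain ⟨z, hz, h0⟩ := H.exists_root_pencil (c := c) hk (t := x k) ⟨le_rfl, H.lt k hk⟩ (by
        have := mul_nonpos_of_nonneg_of_nonpos hc
          (H.right_sign hk (t := x k) ⟨le_rfl, H.lt k hk⟩).le
        simp only [eval_add, eval_mul, eval_C, H.left.isRoot hk]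
        linarith)
      exact ⟨z, fun _ => ⟨hz, h0⟩⟩
    · exact ⟨0, fun h => absurd h hk⟩
  choose z hz using this
  exact ⟨z, hz⟩

section Zeros

variable {c : ℝ} {z : ℕ → ℝ}

theorem listsZeros_pencil (H : Interlacing p q n x y) (hc : 0 ≤ c)
    (hz : ∀ k ∈ Icc 1 n, z k ∈ Ico (x k) (y k) ∧ (p + C c * q).eval (z k) = 0)
    {r : ℝ[X]} (hr : C (1 + c) * r = p + C c * q) (hm : r.Monic) : ListsZeros r n z := by
  have hc' : (1 + c) ≠ 0 := by positivity
  refine hm.listsZeros ?_ (fun j hj k hk hjk => ?_) fun k hk => ?_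
  · rw [← natDegree_C_mul hc', hr]
    refine natDegree_eq_of_le_of_coeff_ne_zero ?_ ?_
    · refine natDegree_add_le_of_degree_le H.left.natDegree.le ?_
      exact (natDegree_C_mul_le _ _).trans H.right.natDegree.le
    · have h1 : p.coeff n = 1 := by simpa [H.left.natDegree] using H.left_monic.coeff_natDegree
      have h2 : q.coeff n = 1 := by simpa [H.right.natDegree] using H.right_monic.coeff_natDegree
      simpa [h1, h2] using hc'
  · exact (hz j hj).1.2.trans ((H.lt_of_lt hj.1 hjk hk.2).trans_le (hz k hk).1.1)
  · have h := congrArg (eval (z k)) hr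
    rw [(hz k hk).2] at h
    simpa [hc'] using h

theorem eq_of_root_pencil (H : Interlacing p q n x y) (hc : 0 ≤ c)
    (hz : ∀ k ∈ Icc 1 n, z k ∈ Ico (x k) (y k) ∧ (p + C c * q).eval (z k) = 0)
    {k : ℕ} (hk : k ∈ Icc 1 n) {w : ℝ} (hw : w ∈ Ico (x k) (y k))
    (h0 : (p + C c * q).eval w = 0) : w = z k := by
  have hc' : (1 + c) ≠ 0 := by positivity
  have hr : C (1 + c) * (C (1 + c)⁻¹ * (p + C c * q)) = p + C c * q := by
    rw [← mul_assoc, ← C_mul, mul_inv_cancel₀ hc', C_1, one_mul]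
  have hm : (C (1 + c)⁻¹ * (p + C c * q)).Monic := by
    have h1 : p.coeff n = 1 := by simpa [H.left.natDegree] using H.left_monic.coeff_natDegree
    have h2 : q.coeff n = 1 := by simpa [H.right.natDegree] using H.right_monic.coeff_natDegree
    refine monic_of_natDegree_le_of_coeff_eq_one n ?_ ?_
    · refine (natDegree_C_mul_le _ _).trans (natDegree_add_le_of_degree_le H.left.natDegree.le ?_)
      exact (natDegree_C_mul_le _ _).trans H.right.natDegree.le
    · simp [h1, h2, hc']
  obtain ⟨j, hj, rfl⟩ := ((H.listsZeros_pencil hc hz hr hm).isRoot_iff w).1 (by simp [h0])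
  rcases lt_trichotomy j k with h | rfl | h
  · exact absurd ((hz j hj).1.2.trans (H.lt_of_lt hj.1 h hk.2)) hw.1.not_gt
  · rfl
  · exact absurd (hw.2.trans (H.lt_of_lt hk.1 h hj.2)) (hz j hj).1.1.not_gt

/-- A point of `[x k, y k)` lies to the left of the `k`-th zero of the pencil as soon as
`p + c q` has there the sign that `q` has on this interval. -/
theorem lt_pencil_zero (H : Interlacing p q n x y) (hc : 0 ≤ c)
    (hz : ∀ k ∈ Icc 1 n, z k ∈ Ico (x k) (y k) ∧ (p + C c * q).eval (z k) = 0)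
    {k : ℕ} (hk : k ∈ Icc 1 n) {t : ℝ} (ht : t ∈ Ico (x k) (y k))
    (hs : (-1) ^ (n - k) * (p + C c * q).eval t < 0) : t < z k := by
  obtain ⟨w, hw, h0⟩ := H.exists_root_pencil hk ht hs.le
  obtain rfl := H.eq_of_root_pencil hc hz hk ⟨ht.1.trans hw.1, hw.2⟩ h0
  refine hw.1.lt_of_ne ?_
  rintro rfl
  simp [h0] at hs

end Zeros

section Family

variable {z : ℝ → ℕ → ℝ}

theorem strictMonoOn_pencil_zero (H : Interlacing p q n x y)
    (hz : ∀ c, 0 ≤ c → ∀ k ∈ Icc 1 n,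
      z c k ∈ Ico (x k) (y k) ∧ (p + C c * q).eval (z c k) = 0)
    {k : ℕ} (hk : k ∈ Icc 1 n) : StrictMonoOn (fun c => z c k) (Ici 0) := by
  intro c hc d hd hcd
  obtain ⟨hmem, h0⟩ := hz c hc k hk
  refine H.lt_pencil_zero hd (hz d hd) hk hmem ?_
  -- subtracting the equation for `c` leaves `(d - c) q` at the zero of `p + c q`
  have h1 := mul_neg_of_pos_of_neg (sub_pos.2 hcd) (H.right_sign hk hmem)
  simp only [eval_add, eval_mul, eval_C] at h0 ⊢
  linear_combination h1 + (-1) ^ (n - k) * h0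

theorem left_lt_pencil_zero (H : Interlacing p q n x y) {c : ℝ} (hc : 0 < c)
    (hz : ∀ k ∈ Icc 1 n, z c k ∈ Ico (x k) (y k) ∧ (p + C c * q).eval (z c k) = 0)
    {k : ℕ} (hk : k ∈ Icc 1 n) : x k < z c k := by
  have hx : x k ∈ Ico (x k) (y k) := ⟨le_rfl, H.lt k hk⟩
  refine H.lt_pencil_zero hc.le hz hk hx ?_
  have h1 := mul_neg_of_pos_of_neg hc (H.right_sign hk hx)
  simp only [eval_add, eval_mul, eval_C, H.left.isRoot hk]
  linarith

theorem tendsto_pencil_zero (H : Interlacing p q n x y)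
    (hz : ∀ c, 0 ≤ c → ∀ k ∈ Icc 1 n,
      z c k ∈ Ico (x k) (y k) ∧ (p + C c * q).eval (z c k) = 0)
    {k : ℕ} (hk : k ∈ Icc 1 n) : Tendsto (fun c => z c k) atTop (𝓝 (y k)) := by
  refine tendsto_order.2 ⟨fun t ht => ?_, fun t ht => ?_⟩
  · have hs : max t (x k) ∈ Ico (x k) (y k) := ⟨le_max_right _ _, max_lt ht (H.lt k hk)⟩
    have hlim : Tendsto (fun c : ℝ => (-1) ^ (n - k) * p.eval (max t (x k)) +
        c * ((-1) ^ (n - k) * q.eval (max t (x k)))) atTop atBot :=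
      tendsto_atBot_add_const_left _ _
        (tendsto_id.atTop_mul_const_of_neg (H.right_sign hk hs))
    filter_upwards [hlim.eventually_lt_atBot 0, eventually_ge_atTop 0] with c hc hc0
    refine (le_max_left _ _).trans_lt (H.lt_pencil_zero hc0 (hz c hc0) hk hs ?_)
    simp only [eval_add, eval_mul, eval_C]
    linarith
  · filter_upwards [eventually_ge_atTop 0] with c hc
    exact (hz c hc k hk).1.2.trans ht

/-- The zeros of `p + c q` approach those of `q` at the rate `1 / c`. -/
theorem tendsto_mul_sub_pencil_zero (H : Interlacing p q n x y)
    (hz : ∀ c, 0 ≤ c → ∀ k ∈ Icc 1 n,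
      z c k ∈ Ico (x k) (y k) ∧ (p + C c * q).eval (z c k) = 0)
    {k : ℕ} (hk : k ∈ Icc 1 n) : Tendsto (fun c => c * (y k - z c k)) atTop
      (𝓝 (p.eval (y k) / q.derivative.eval (y k))) := by
  obtain ⟨r, hr, hsign⟩ := H.right.exists_cofactor H.right_monic hk
  have hr0 : r.eval (y k) ≠ 0 := fun h => by simp [h] at hsign
  have hder : q.derivative.eval (y k) = r.eval (y k) := by simp [hr]
  have hlim := H.tendsto_pencil_zero hz hk
  have hrlim := (r.continuous.tendsto (y k)).comp hlim
  rw [hder]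
  refine Tendsto.congr' ?_ (((p.continuous.tendsto (y k)).comp hlim).div hrlim hr0)
  filter_upwards [eventually_ge_atTop 0, hrlim.eventually_ne hr0] with c hc hne
  have h0 := (hz c hc k hk).2
  simp only [eval_add, eval_mul, eval_C, hr, eval_sub, eval_X] at h0
  simp only [Function.comp_apply, Pi.div_apply] at hne ⊢
  rw [div_eq_iff hne]
  linear_combination h0

end Family

end Interlacing

/-! ### Orthogonal polynomials and their zeros -/

theorem Polynomial.degree_C_mul_le {R : Type*} [Semiring R] (c : R) (p : R[X]) :
    (C c * p).degree ≤ p.degree := by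
  rw [← smul_eq_C_mul]
  exact degree_smul_le c p

section Orthogonality

variable {μ : Measure ℝ}

theorem ae_le_of_isLUB_convexHull_support {η a : ℝ} (hη : IsLUB (convexHull ℝ μ.support) η)
    (ha : η ≤ a) : ∀ᵐ x ∂μ, x ≤ a := by
  filter_upwards [Measure.support_mem_ae (μ := μ)] with x hx
  exact (hη.1 (subset_convexHull ℝ _ hx)).trans ha

/-- `polyInner_self_pos` for polynomials that are only nonnegative on the support. -/
theorem integral_eval_pos (hmom : ∀ n : ℕ, Integrable (fun x : ℝ => |x| ^ n) μ)
    (hinf : μ.support.Infinite) {f : ℝ[X]} (hf : f ≠ 0) (h : ∀ᵐ x ∂μ, 0 ≤ f.eval x) :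
    0 < ∫ x, f.eval x ∂μ := by
  rw [integral_pos_iff_support_of_nonneg_ae h (integrable_polyEval hmom f)]
  obtain ⟨t, ht, htp⟩ := hinf.exists_notMem_finset f.roots.toFinset
  rw [Measure.mem_support_iff_forall] at ht
  exact ht _ (f.continuous.isOpen_support.mem_nhds (by simpa [hf] using htp))

theorem polyInner_mul_left (p q r : ℝ[X]) :
    polyInner μ (p * q) r = polyInner μ p (q * r) := by
  simp [polyInner, mul_assoc]

theorem polyInner_sub_right (hmom : ∀ n : ℕ, Integrable (fun x : ℝ => |x| ^ n) μ)
    (p q r : ℝ[X]) : polyInner μ p (q - r) = polyInner μ p q - polyInner μ p r := by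
  simp only [polyInner_comm μ p, polyInner_sub_left hmom]

theorem polyInner_C_mul_right (μ : Measure ℝ) (c : ℝ) (p q : ℝ[X]) :
    polyInner μ p (C c * q) = c * polyInner μ p q := by
  simp only [polyInner_comm μ p, polyInner_C_mul_left]

theorem polyInner_mops_eq_zero (hmom : ∀ n : ℕ, Integrable (fun x : ℝ => |x| ^ n) μ)
    (hinf : μ.support.Infinite) {n : ℕ} {q : ℝ[X]} (hq : q.degree < n) :
    polyInner μ q (mops μ n) = 0 :=
  (isMOPS_mops hmom hinf).orthogonal_of_degree_lt hmom n n le_rfl q hq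

theorem eq_mops_of_orthogonal (hmom : ∀ n : ℕ, Integrable (fun x : ℝ => |x| ^ n) μ)
    (hinf : μ.support.Infinite) {n : ℕ} {p : ℝ[X]} (hp : p.Monic) (hd : p.natDegree = n)
    (h : ∀ q : ℝ[X], q.degree < n → polyInner μ q p = 0) : mops μ n = p := by
  obtain ⟨hm, hmd⟩ := mops_monic_natDegree μ n
  have hdeg : (mops μ n - p).degree < n := by
    have := degree_sub_lt_left (p := mops μ n) (q := p)
      (by rw [degree_eq_natDegree hm.ne_zero, degree_eq_natDegree hp.ne_zero, hmd, hd])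
      hm.ne_zero (by rw [hm.leadingCoeff, hp.leadingCoeff])
    rwa [degree_eq_natDegree hm.ne_zero, hmd] at this
  by_contra hne
  have h0 := polyInner_self_pos hmom hinf (sub_ne_zero.2 hne)
  rw [polyInner_sub_right hmom, polyInner_mops_eq_zero hmom hinf hdeg, h _ hdeg] at h0
  simp at h0

/-- An orthogonal polynomial has no nontrivial factor of constant sign on the support: the
complementary factor `r` would satisfy `∫ s r² = 0`. -/
theorem false_of_mops_eq_mul (hmom : ∀ n : ℕ, Integrable (fun x : ℝ => |x| ^ n) μ)
    (hinf : μ.support.Infinite) {n : ℕ} {s r : ℝ[X]} (h : mops μ n = s * r)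
    (hs : 0 < s.natDegree) (hpos : ∀ᵐ x ∂μ, 0 ≤ s.eval x) : False := by
  obtain ⟨hm, hmd⟩ := mops_monic_natDegree μ n
  have hne : s * r ≠ 0 := h ▸ hm.ne_zero
  have hr : r ≠ 0 := right_ne_zero_of_mul hne
  have hd : r.degree < n := by
    rw [h, natDegree_mul (left_ne_zero_of_mul hne) hr] at hmd
    rw [degree_eq_natDegree hr]
    exact_mod_cast (by omega : r.natDegree < n)
  have h0 := polyInner_mops_eq_zero hmom hinf hd
  have h1 := integral_eval_pos hmom hinf (f := r * (s * r)) (mul_ne_zero hr hne) (by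
    filter_upwards [hpos] with x hx
    have := mul_nonneg hx (mul_self_nonneg (r.eval x))
    simp only [eval_mul]
    linarith)
  rw [h] at h0
  simp only [polyInner, ← eval_mul] at h0
  exact h1.ne' h0

/-- The zeros of the orthogonal polynomials are real, simple, and to the left of every upper
bound of the support. -/
theorem exists_listsZeros_mops (hmom : ∀ n : ℕ, Integrable (fun x : ℝ => |x| ^ n) μ)
    (hinf : μ.support.Infinite) {a : ℝ} (ha : ∀ᵐ x ∂μ, x ≤ a) (n : ℕ) :
    ∃ x : ℕ → ℝ, ListsZeros (mops μ n) n x ∧ ∀ k ∈ Icc 1 n, x k < a := by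
  obtain ⟨hm, hmd⟩ := mops_monic_natDegree μ n
  have hsplits : (mops μ n).Splits := by
    refine Splits.of_splits_map (algebraMap ℝ ℂ) (IsAlgClosed.splits _) fun z hz => ?_
    have hz0 : aeval z (mops μ n) = 0 := by
      rw [mem_roots (map_ne_zero hm.ne_zero)] at hz
      simpa [aeval_def, eval_map] using hz
    by_cases him : z.im = 0
    · exact ⟨z.re, Complex.ext (by simp) (by simp [him])⟩
    -- a nonreal zero gives a quadratic factor without sign changes
    · obtain ⟨r, hr⟩ := quadratic_dvd_of_aeval_eq_zero_im_ne_zero _ hz0 him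
      have hdeg : (X ^ 2 - C (2 * z.re) * X + C (‖z‖ ^ 2) : ℝ[X]).natDegree = 2 := by
        compute_degree!
      refine (false_of_mops_eq_mul hmom hinf hr (by omega) (ae_of_all _ fun x => ?_)).elim
      have : ‖z‖ ^ 2 = z.re ^ 2 + z.im ^ 2 := by
        rw [← Complex.normSq_eq_norm_sq, Complex.normSq_apply]; ring
      simp only [eval_add, eval_sub, eval_mul, eval_pow, eval_X, eval_C, this]
      nlinarith [sq_nonneg (x - z.re), sq_nonneg z.im]
  have hnodup : (mops μ n).roots.Nodup := by
    rw [Multiset.nodup_iff_count_le_one]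
    intro t
    by_contra! ht
    rw [count_roots] at ht
    obtain ⟨r, hr⟩ := (le_rootMultiplicity_iff hm.ne_zero).1 ht
    refine false_of_mops_eq_mul hmom hinf hr (by simp) (ae_of_all _ fun x => ?_)
    simpa using sq_nonneg (x - t)
  have hlt : ∀ t, (mops μ n).eval t = 0 → t < a := by
    intro t ht
    by_contra! hat
    obtain ⟨r, hr⟩ := dvd_iff_isRoot.2 ht
    have hr' : mops μ n = (C t - X) * -r := by rw [hr]; ring
    refine false_of_mops_eq_mul hmom hinf hr' ?_ ?_
    · rw [← natDegree_neg, neg_sub, natDegree_X_sub_C]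
      exact one_pos
    · filter_upwards [ha] with x hx
      simpa using hx.trans hat
  have hcard : (mops μ n).roots.toFinset.card = n := by
    rw [Multiset.toFinset_card_of_nodup hnodup, ← hsplits.natDegree_eq_card_roots, hmd]
  let e := (mops μ n).roots.toFinset.orderEmbOfFin hcard
  let x : ℕ → ℝ := fun k => if h : k - 1 < n then e ⟨k - 1, h⟩ else 0
  have hx : ∀ k ∈ Icc 1 n, (mops μ n).eval (x k) = 0 := by
    intro k hk
    have h : k - 1 < n := by have := hk.1; have := hk.2; omega
    have := (mops μ n).roots.toFinset.orderEmbOfFin_mem hcard ⟨k - 1, h⟩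
    rw [Multiset.mem_toFinset] at this
    simp only [x, dif_pos h, e]
    exact isRoot_of_mem_roots this
  refine ⟨x, hm.listsZeros hmd (fun j hj k hk hjk => ?_) hx, fun k hk => hlt _ (hx k hk)⟩
  obtain ⟨hj1, hjn⟩ := hj
  obtain ⟨hk1, hkn⟩ := hk
  simp only [x, dif_pos (show j - 1 < n by omega), dif_pos (show k - 1 < n by omega)]
  exact e.strictMono (Fin.mk_lt_mk.2 (by omega))

/-! ### The kernel polynomial -/

/-- The polynomial `x ↦ K_{n-1}(x, a)`, of degree less than `n`. -/
noncomputable def kernelPolynomial (μ : Measure ℝ) (n : ℕ) (a : ℝ) : ℝ[X] :=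
  ∑ j ∈ Finset.range n, C ((mops μ j).eval a / polyInner μ (mops μ j) (mops μ j)) * mops μ j

theorem eval_kernelPolynomial_self (μ : Measure ℝ) {n : ℕ} (hn : 1 ≤ n) (a : ℝ) :
    (kernelPolynomial μ n a).eval a = kernelPoly μ (n - 1) a a := by
  rw [kernelPoly, Nat.sub_add_cancel hn, kernelPolynomial, eval_finsetSum]
  refine Finset.sum_congr rfl fun j _ => ?_
  rw [eval_mul, eval_C]
  ring

theorem degree_kernelPolynomial_lt (μ : Measure ℝ) (n : ℕ) (a : ℝ) :
    (kernelPolynomial μ n a).degree < n := by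
  refine (degree_sum_le _ _).trans_lt ((Finset.sup_lt_iff (WithBot.bot_lt_coe n)).2 fun j hj => ?_)
  refine (degree_C_mul_le _ _).trans_lt ?_
  rw [degree_eq_natDegree (mops_monic_natDegree μ j).1.ne_zero, (mops_monic_natDegree μ j).2]
  exact WithBot.coe_lt_coe.2 (Finset.mem_range.1 hj)

theorem kernelPoly_self_pos (hmom : ∀ n : ℕ, Integrable (fun x : ℝ => |x| ^ n) μ)
    (hinf : μ.support.Infinite) (n : ℕ) (a : ℝ) : 0 < kernelPoly μ n a a := by
  have hpos (j : ℕ) := polyInner_self_pos hmom hinf (mops_monic_natDegree μ j).1.ne_zero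
  refine Finset.sum_pos' (fun j _ => div_nonneg (mul_self_nonneg _) (hpos j).le)
    ⟨0, by simp, ?_⟩
  have h0 : mops μ 0 = 1 :=
    (mops_monic_natDegree μ 0).1.natDegree_eq_zero.1 (mops_monic_natDegree μ 0).2
  have := hpos 0
  rw [h0] at this ⊢
  simpa using this

/-- The reproducing property of the kernel. -/
theorem polyInner_kernelPolynomial (hmom : ∀ n : ℕ, Integrable (fun x : ℝ => |x| ^ n) μ)
    (hinf : μ.support.Infinite) {n : ℕ} {q : ℝ[X]} (hq : q.degree < n) (a : ℝ) :
    polyInner μ q (kernelPolynomial μ n a) = q.eval a := by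
  have horth := (isMOPS_mops hmom hinf).orthogonal
  have hbasis : ∀ d < n, polyInner μ (mops μ d) (kernelPolynomial μ n a) = (mops μ d).eval a := by
    intro d hd
    have := polyInner_self_pos hmom hinf (mops_monic_natDegree μ d).1.ne_zero
    rw [polyInner_comm, kernelPolynomial, polyInner_sum_left hmom,
      Finset.sum_eq_single_of_mem d (Finset.mem_range.2 hd)]
    · rw [polyInner_C_mul_left]
      field_simp
    · intro j _ hj
      rw [polyInner_C_mul_left, horth d j hj.symm, mul_zero]
  suffices ∀ d ≤ n, ∀ q : ℝ[X], q.degree < d →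
      polyInner μ q (kernelPolynomial μ n a) = q.eval a from this n le_rfl q hq
  intro d
  induction d with
  | zero =>
    intro _ q hq
    have : q = 0 := by simpa using hq
    simp [this, polyInner]
  | succ d ih =>
    intro hd q hq
    obtain ⟨hm, hmd⟩ := mops_monic_natDegree μ d
    have hlow : (q - C (q.coeff d) * mops μ d).degree < d := by
      rw [degree_lt_iff_coeff_zero]
      intro m hm'
      rcases hm'.eq_or_lt with rfl | hlt
      · have : (mops μ d).coeff d = 1 := by simpa [hmd] using hm.coeff_natDegree
        simp [this]
      · have h1 := (degree_lt_iff_coeff_zero _ _).1 hq m hlt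
        have h2 : (mops μ d).coeff m = 0 := coeff_eq_zero_of_natDegree_lt (by omega)
        simp [h1, h2]
    have h := ih (by omega) _ hlow
    rw [polyInner_sub_left hmom, polyInner_C_mul_left, hbasis d hd] at h
    simp only [eval_sub, eval_mul, eval_C] at h
    linarith

/-- The kernel has at the zeros of `mops μ n` the sign of the cofactor `r`. By orthogonality to
multiples of lower degree, `∫ K r` depends only on the value of `K` at the zero `t`, so that
`r(a) r(t) = K(t) ∫ r²`. -/
theorem eval_mul_eval_kernelPolynomial
    (hmom : ∀ n : ℕ, Integrable (fun x : ℝ => |x| ^ n) μ) (hinf : μ.support.Infinite)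
    {n : ℕ} {t : ℝ} {r : ℝ[X]} (hr : mops μ n = (X - C t) * r) (a : ℝ) :
    r.eval a * r.eval t = (kernelPolynomial μ n a).eval t * polyInner μ r r := by
  obtain ⟨hm, hmd⟩ := mops_monic_natDegree μ n
  set K := kernelPolynomial μ n a
  have hr0 : r ≠ 0 := by rintro rfl; simp [hr] at hm
  have hrd : r.degree < n := by
    rw [hr, natDegree_mul (X_sub_C_ne_zero t) hr0, natDegree_X_sub_C] at hmd
    rw [degree_eq_natDegree hr0]
    exact_mod_cast (by omega : r.natDegree < n)
  have hKd : K.degree < n := degree_kernelPolynomial_lt μ n a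
  -- the combination `r(t) K - K(t) r` vanishes at `t`
  obtain ⟨s, hs⟩ := dvd_iff_isRoot.2
    (show (C (r.eval t) * K - C (K.eval t) * r).IsRoot t by simp [mul_comm])
  have hsd : s.degree < n := by
    by_cases hs0 : s = 0
    · simp [hs0]
    have h : (C (r.eval t) * K - C (K.eval t) * r).degree < n :=
      (degree_sub_le _ _).trans_lt (max_lt ((degree_C_mul_le _ _).trans_lt hKd)
        ((degree_C_mul_le _ _).trans_lt hrd))
    refine lt_of_le_of_lt ?_ h
    rw [hs, mul_comm]
    exact degree_le_mul_left s (X_sub_C_ne_zero t)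
  have h1 : polyInner μ r (C (r.eval t) * K - C (K.eval t) * r) = 0 := by
    rw [hs, ← polyInner_mul_left, mul_comm r, ← hr, polyInner_comm]
    exact polyInner_mops_eq_zero hmom hinf hsd
  rw [polyInner_sub_right hmom, polyInner_C_mul_right, polyInner_C_mul_right,
    polyInner_kernelPolynomial hmom hinf hrd] at h1
  linarith

/-! ### The perturbed measures -/

theorem integrable_eval_iteratedChristoffel
    (hmom : ∀ n : ℕ, Integrable (fun x : ℝ => |x| ^ n) μ) (a : ℝ) (n : ℕ) :
    Integrable (fun x : ℝ => |x| ^ n) (iteratedChristoffel μ a) := by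
  rw [iteratedChristoffel, integrable_withDensity_iff_integrable_smul' (by fun_prop) (by simp)]
  refine ((integrable_polyEval hmom ((X - C a) ^ 2 * X ^ n)).abs).congr (ae_of_all _ fun x => ?_)
  simp [ENNReal.toReal_ofReal (sq_nonneg (x - a)), abs_mul]

theorem polyInner_iteratedChristoffel (μ : Measure ℝ) (a : ℝ) (p q : ℝ[X]) :
    polyInner (iteratedChristoffel μ a) p q = polyInner μ ((X - C a) * p) ((X - C a) * q) := by
  rw [polyInner, iteratedChristoffel,
    integral_withDensity_eq_integral_toReal_smul (by fun_prop) (by simp)]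
  refine integral_congr_ae (ae_of_all _ fun x => ?_)
  simp only [ENNReal.toReal_ofReal (sq_nonneg (x - a)), smul_eq_mul, eval_mul, eval_sub, eval_X,
    eval_C]
  ring

theorem infinite_support_iteratedChristoffel (hinf : μ.support.Infinite) (a : ℝ) :
    (iteratedChristoffel μ a).support.Infinite := by
  refine (hinf.sdiff (finite_singleton a)).mono fun t ht => ?_
  rw [Measure.mem_support_iff_forall]
  intro U hU
  have hpos := (Measure.mem_support_iff_forall t).1 ht.1 _
    (inter_mem (isOpen_ne.mem_nhds ht.2) hU)
  rw [pos_iff_ne_zero] at hpos ⊢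
  rw [iteratedChristoffel, Ne, withDensity_apply_eq_zero (by fun_prop)]
  convert hpos using 4
  ext x
  simp [sub_eq_zero]

theorem integrable_eval_uvarov (hmom : ∀ n : ℕ, Integrable (fun x : ℝ => |x| ^ n) μ)
    (a N : ℝ) (n : ℕ) : Integrable (fun x : ℝ => |x| ^ n) (uvarov μ a N) :=
  (hmom n).add_measure ((integrable_dirac (by simp)).smul_measure ENNReal.ofReal_ne_top)

theorem infinite_support_uvarov (hinf : μ.support.Infinite) (a N : ℝ) :
    (uvarov μ a N).support.Infinite :=
  hinf.mono (Measure.support_mono (Measure.le_add_right le_rfl))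

theorem polyInner_uvarov (hmom : ∀ n : ℕ, Integrable (fun x : ℝ => |x| ^ n) μ)
    (a : ℝ) {N : ℝ} (hN : 0 ≤ N) (p q : ℝ[X]) :
    polyInner (uvarov μ a N) p q = polyInner μ p q + N * (p.eval a * q.eval a) := by
  have hint : Integrable (fun x => p.eval x * q.eval x) μ := by
    simpa using integrable_polyEval hmom (p * q)
  rw [polyInner, uvarov, integral_add_measure hint
    ((integrable_dirac (by simpa using ENNReal.mul_lt_top enorm_lt_top enorm_lt_top)).smul_measure
      ENNReal.ofReal_ne_top), integral_smul_measure, integral_dirac, ENNReal.toReal_ofReal hN,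
    smul_eq_mul, polyInner]

end Orthogonality

/-! ### Reduction to a pencil -/

section Perturbed

variable {μ : Measure ℝ}

/-- Up to the factor `X - a`, the polynomials of `(x - a)² dμ` arise from those of `μ` by
subtracting the multiple of the kernel that makes them vanish at `a`. -/
theorem X_sub_C_mul_mops_iteratedChristoffel
    (hmom : ∀ n : ℕ, Integrable (fun x : ℝ => |x| ^ n) μ) (hinf : μ.support.Infinite)
    {n : ℕ} (hn : 1 ≤ n) (a : ℝ) :
    (X - C a) * mops (iteratedChristoffel μ a) (n - 1) =
      mops μ n - C ((mops μ n).eval a / kernelPoly μ (n - 1) a a) * kernelPolynomial μ n a := by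
  obtain ⟨hm, hmd⟩ := mops_monic_natDegree μ n
  have hB := kernelPoly_self_pos hmom hinf (n - 1) a
  set Q := mops μ n - C ((mops μ n).eval a / kernelPoly μ (n - 1) a a) * kernelPolynomial μ n a
    with hQ
  have hdeg : (C ((mops μ n).eval a / kernelPoly μ (n - 1) a a) *
      kernelPolynomial μ n a).degree < (mops μ n).degree := by
    rw [degree_eq_natDegree hm.ne_zero, hmd]
    exact (degree_C_mul_le _ _).trans_lt (degree_kernelPolynomial_lt μ n a)
  have hQm : Q.Monic := hm.sub_of_left hdeg
  have hQd : Q.natDegree = n := by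
    rw [hQ, natDegree_eq_of_degree_eq (degree_sub_eq_left_of_degree_lt hdeg), hmd]
  have hQa : Q.eval a = 0 := by
    simp only [hQ, eval_sub, eval_mul, eval_C, eval_kernelPolynomial_self μ hn]
    field_simp
    ring
  obtain ⟨P, hP⟩ := dvd_iff_isRoot.2 hQa
  have hPm : P.Monic := (monic_X_sub_C a).of_mul_monic_left (hP ▸ hQm)
  have hPd : P.natDegree = n - 1 := by
    rw [hP, (monic_X_sub_C a).natDegree_mul hPm, natDegree_X_sub_C] at hQd
    omega
  suffices mops (iteratedChristoffel μ a) (n - 1) = P by rw [hP, this]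
  refine eq_mops_of_orthogonal (integrable_eval_iteratedChristoffel hmom a)
    (infinite_support_iteratedChristoffel hinf a) hPm hPd fun q hq => ?_
  have hXq : ((X - C a) * q).degree < (n : WithBot ℕ) := by
    by_cases hq0 : q = 0
    · simp [hq0]
    rw [degree_eq_natDegree hq0] at hq
    have hq' : q.natDegree < n - 1 := by exact_mod_cast hq
    rw [degree_eq_natDegree (mul_ne_zero (X_sub_C_ne_zero a) hq0),
      natDegree_mul (X_sub_C_ne_zero a) hq0, natDegree_X_sub_C]
    exact_mod_cast (by omega : 1 + q.natDegree < n)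
  rw [polyInner_iteratedChristoffel, ← hP, hQ, polyInner_sub_right hmom, polyInner_C_mul_right,
    polyInner_mops_eq_zero hmom hinf hXq, polyInner_kernelPolynomial hmom hinf hXq]
  simp

/-- The polynomials of `μ + N δ_a` form, after rescaling the parameter, the pencil spanned by
those of `μ` and of `(x - a)² dμ`. -/
theorem C_mul_mops_uvarov
    (hmom : ∀ n : ℕ, Integrable (fun x : ℝ => |x| ^ n) μ) (hinf : μ.support.Infinite)
    {n : ℕ} (hn : 1 ≤ n) (a : ℝ) {N : ℝ} (hN : 0 ≤ N) :
    C (1 + kernelPoly μ (n - 1) a a * N) * mops (uvarov μ a N) n =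
      mops μ n + C (kernelPoly μ (n - 1) a a * N) *
        ((X - C a) * mops (iteratedChristoffel μ a) (n - 1)) := by
  obtain ⟨hm, hmd⟩ := mops_monic_natDegree μ n
  have hB := kernelPoly_self_pos hmom hinf (n - 1) a
  have hc : 1 + kernelPoly μ (n - 1) a a * N ≠ 0 := by positivity
  have hQ := X_sub_C_mul_mops_iteratedChristoffel hmom hinf hn a
  set B := kernelPoly μ (n - 1) a a
  set e := N * (mops μ n).eval a / (1 + B * N) with he
  have hdeg : (C e * kernelPolynomial μ n a).degree < (mops μ n).degree := by
    rw [degree_eq_natDegree hm.ne_zero, hmd]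
    exact (degree_C_mul_le _ _).trans_lt (degree_kernelPolynomial_lt μ n a)
  have hN' : mops (uvarov μ a N) n = mops μ n - C e * kernelPolynomial μ n a := by
    refine eq_mops_of_orthogonal (integrable_eval_uvarov hmom a N)
      (infinite_support_uvarov hinf a N) (hm.sub_of_left hdeg)
      ((natDegree_eq_of_degree_eq (degree_sub_eq_left_of_degree_lt hdeg)).trans hmd)
      fun q hq => ?_
    rw [polyInner_uvarov hmom a hN, polyInner_sub_right hmom, polyInner_C_mul_right,
      polyInner_mops_eq_zero hmom hinf hq, polyInner_kernelPolynomial hmom hinf hq]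
    simp only [eval_sub, eval_mul, eval_C, eval_kernelPolynomial_self μ hn, he]
    field_simp
    ring
  rw [hN', hQ]
  have h1 : C (1 + B * N) * C e = (C (B * N) * C ((mops μ n).eval a / B) : ℝ[X]) := by
    rw [← C_mul, ← C_mul, he]
    congr 1
    field_simp
  have h2 : (C (1 + B * N) : ℝ[X]) = 1 + C (B * N) := by simp
  linear_combination (-kernelPolynomial μ n a) * h1 + mops μ n * h2

/-! ### Interlacing and the behaviour of the zeros -/

theorem exists_interlacing_iteratedChristoffel
    (hmom : ∀ n : ℕ, Integrable (fun x : ℝ => |x| ^ n) μ) (hinf : μ.support.Infinite)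
    {n : ℕ} (hn : 1 ≤ n) {a : ℝ} {x : ℕ → ℝ} (hx : ListsZeros (mops μ n) n x)
    (hxa : ∀ k ∈ Icc 1 n, x k < a) :
    ∃ y : ℕ → ℝ, y n = a ∧ Interlacing (mops μ n)
      ((X - C a) * mops (iteratedChristoffel μ a) (n - 1)) n x y := by
  have hm := (mops_monic_natDegree μ n).1
  have hB := kernelPoly_self_pos hmom hinf (n - 1) a
  have hpa : 0 < (mops μ n).eval a := by
    simpa using hx.neg_one_pow_mul_eval_pos hm le_rfl (t := a) (fun h => hxa n ⟨h, le_rfl⟩)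
      (fun h => absurd h (lt_irrefl n))
  have hQ := X_sub_C_mul_mops_iteratedChristoffel hmom hinf hn a
  obtain ⟨hPm, hPd⟩ := mops_monic_natDegree (iteratedChristoffel μ a) (n - 1)
  have hQm := (monic_X_sub_C a).mul hPm
  have hQd : ((X - C a) * mops (iteratedChristoffel μ a) (n - 1)).natDegree = n := by
    rw [(monic_X_sub_C a).natDegree_mul hPm, natDegree_X_sub_C, hPd]
    omega
  have hQa : ((X - C a) * mops (iteratedChristoffel μ a) (n - 1)).eval a = 0 := by simp
  set Q := (X - C a) * mops (iteratedChristoffel μ a) (n - 1)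
  have hsign : ∀ k ∈ Icc 1 n, (-1) ^ (n - k) * Q.eval (x k) < 0 := by
    intro k hk
    obtain ⟨r, hr, hrsign⟩ := hx.exists_cofactor hm hk
    have hK := eval_mul_eval_kernelPolynomial hmom hinf hr a
    have hra : 0 < r.eval a := by
      have h := hpa
      rw [hr, eval_mul, eval_sub, eval_X, eval_C] at h
      exact pos_of_mul_pos_right h (sub_pos.2 (hxa k hk)).le
    have hrr : 0 < polyInner μ r r :=
      polyInner_self_pos hmom hinf (by rintro rfl; simp at hra)
    have hKpos : 0 < (-1) ^ (n - k) * (kernelPolynomial μ n a).eval (x k) := by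
      refine pos_of_mul_pos_left (b := polyInner μ r r) ?_ hrr.le
      rw [mul_assoc, ← hK]
      have := mul_pos hra hrsign
      linarith
    have := mul_pos (div_pos hpa hB) hKpos
    simp only [hQ, eval_sub, eval_mul, eval_C, hx.isRoot hk]
    linarith
  -- consecutive signs of `q` at the zeros of `p` differ
  have hgap : ∀ k, ∃ t, (k ∈ Icc 1 (n - 1) → t ∈ Ioo (x k) (x (k + 1)) ∧ Q.eval t = 0) ∧
      (k = n → t = a) := by
    intro k
    by_cases hk : k ∈ Icc 1 (n - 1)
    · obtain ⟨hk1, hkn⟩ := hk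
      have hlt : x k < x (k + 1) :=
        hx.strictMonoOn ⟨hk1, by omega⟩ ⟨by omega, by omega⟩ (by omega)
      have h1 := hsign k ⟨hk1, by omega⟩
      have h2 := hsign (k + 1) ⟨by omega, by omega⟩
      rw [show n - k = n - (k + 1) + 1 by omega, pow_succ] at h1
      obtain ⟨t, ht, h0⟩ := intermediate_value_Ioo' hlt.le
        (f := fun u => (-1) ^ (n - (k + 1)) * Q.eval u) (by fun_prop)
        (show (0 : ℝ) ∈ Ioo _ _ from ⟨h2, by linarith⟩)
      exact ⟨t, fun _ => ⟨ht, by simpa using h0⟩, fun h => by omega⟩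
    · exact ⟨a, fun h => absurd h hk, fun _ => rfl⟩
  choose y hy using hgap
  have hyn : y n = a := (hy n).2 rfl
  have hxy : ∀ k ∈ Icc 1 n, x k < y k := by
    intro k hk
    by_cases hkn : k = n
    · rw [hkn, hyn]
      exact hxa n ⟨hn, le_rfl⟩
    · exact ((hy k).1 ⟨hk.1, by have := hk.2; omega⟩).1.1
  have hyx : ∀ k ∈ Icc 1 (n - 1), y k < x (k + 1) := fun k hk => ((hy k).1 hk).1.2
  refine ⟨y, hyn, hm, hQm, hx, hQm.listsZeros hQd (fun j hj k hk hjk => ?_) (fun k hk => ?_),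
    hxy, hyx⟩
  · have hj' : j ∈ Icc 1 (n - 1) := ⟨hj.1, by have := hk.2; omega⟩
    have hle : x (j + 1) ≤ x k :=
      hx.strictMonoOn.monotoneOn ⟨by omega, hjk.trans_le hk.2⟩ hk hjk
    exact (hyx j hj').trans_le (hle.trans (hxy k hk).le)
  · by_cases hkn : k = n
    · rw [hkn, hyn, hQa]
    · exact ((hy k).1 ⟨hk.1, by have := hk.2; omega⟩).2

end Perturbed

theorem theorem4 (μ : MeasureTheory.Measure ℝ)
    (hmom : ∀ m : ℕ, MeasureTheory.Integrable (fun x : ℝ => |x| ^ m) μ)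
    (hinf : μ.support.Infinite)
    (η : ℝ) (hη : IsLUB (convexHull ℝ μ.support) η)
    (a : ℝ) (ha : η ≤ a) (n : ℕ) (hn : 1 ≤ n) :
    ∃ (x xs : ℕ → ℝ) (xN : ℝ → ℕ → ℝ),
      -- `x k`, `xs k`, `xN N k` are the increasingly ordered zeros
      ListsZeros (mops μ n) n x ∧
      ListsZeros (mops (iteratedChristoffel μ a) (n - 1)) (n - 1) xs ∧
      (∀ N : ℝ, 0 ≤ N → ListsZeros (mops (uvarov μ a N) n) n (xN N)) ∧
      -- interlacing
      (∀ N : ℝ, 0 < N →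
        (∀ k ∈ Set.Icc 1 (n - 1), x k < xN N k ∧ xN N k < xs k ∧ xs k < x (k + 1)) ∧
        x n < xN N n ∧ xN N n < a) ∧
      -- monotonicity in the mass
      (∀ k ∈ Set.Icc 1 n, StrictMonoOn (fun N : ℝ => xN N k) (Set.Ici 0)) ∧
      -- limits
      Filter.Tendsto (fun N : ℝ => xN N n) Filter.atTop (nhds a) ∧
      (∀ k ∈ Set.Icc 1 (n - 1),
        Filter.Tendsto (fun N : ℝ => xN N k) Filter.atTop (nhds (xs k))) ∧
      -- speed of convergence
      Filter.Tendsto (fun N : ℝ => N * (a - xN N n)) Filter.atTop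
        (nhds ((mops μ n).eval a /
          (kernelPoly μ (n - 1) a a * (mops (iteratedChristoffel μ a) (n - 1)).eval a))) ∧
      (∀ k ∈ Set.Icc 1 (n - 1),
        Filter.Tendsto (fun N : ℝ => N * (xs k - xN N k)) Filter.atTop
          (nhds ((mops μ n).eval (xs k) /
            (kernelPoly μ (n - 1) a a * (xs k - a) *
              (mops (iteratedChristoffel μ a) (n - 1)).derivative.eval (xs k))))) := by
  obtain ⟨x, hx, hxa⟩ :=
    exists_listsZeros_mops hmom hinf (ae_le_of_isLUB_convexHull_support hη ha) n
  obtain ⟨y, hyn, H⟩ := exists_interlacing_iteratedChristoffel hmom hinf hn hx hxa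
  have hB := kernelPoly_self_pos hmom hinf (n - 1) a
  have hpencil := fun N (hN : 0 ≤ N) => C_mul_mops_uvarov hmom hinf hn a hN
  obtain ⟨hPm, hPd⟩ := mops_monic_natDegree (iteratedChristoffel μ a) (n - 1)
  set B := kernelPoly μ (n - 1) a a
  set P := mops (iteratedChristoffel μ a) (n - 1)
  have hIcc : ∀ k ∈ Icc 1 (n - 1), k ∈ Icc 1 n := fun k hk => ⟨hk.1, by have := hk.2; omega⟩
  have hnn : n ∈ Icc 1 n := ⟨hn, le_rfl⟩
  have hya : ∀ k ∈ Icc 1 (n - 1), y k - a ≠ 0 := fun k hk => by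
    have hlt := H.right.strictMonoOn (hIcc k hk) hnn (by have := hk.1; have := hk.2; omega)
    rw [hyn] at hlt
    exact (sub_neg.2 hlt).ne
  have hyP : ∀ k ∈ Icc 1 (n - 1), P.eval (y k) = 0 := fun k hk => by
    have h := H.right.isRoot (hIcc k hk)
    rw [eval_mul, eval_sub, eval_X, eval_C] at h
    exact (mul_eq_zero.1 h).resolve_left (hya k hk)
  have hder (t : ℝ) : ((X - C a) * P).derivative.eval t =
      P.eval t + (t - a) * P.derivative.eval t := by simp
  have hz (c : ℝ) : ∃ z : ℕ → ℝ, 0 ≤ c → ∀ k ∈ Icc 1 n, z k ∈ Ico (x k) (y k) ∧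
      (mops μ n + C c * ((X - C a) * P)).eval (z k) = 0 := by
    by_cases hc : 0 ≤ c
    · obtain ⟨z, hz⟩ := H.exists_pencil_zeros hc
      exact ⟨z, fun _ => hz⟩
    · exact ⟨x, fun h => absurd h hc⟩
  choose z hz using hz
  have hscale : Tendsto (fun N : ℝ => B * N) atTop atTop := tendsto_id.const_mul_atTop hB
  have hlim : ∀ k ∈ Icc 1 n, Tendsto (fun N => z (B * N) k) atTop (𝓝 (y k)) :=
    fun k hk => (H.tendsto_pencil_zero hz hk).comp hscale
  have hrate : ∀ k ∈ Icc 1 n, Tendsto (fun N => N * (y k - z (B * N) k)) atTop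
      (𝓝 ((mops μ n).eval (y k) / (B * ((X - C a) * P).derivative.eval (y k)))) := by
    intro k hk
    have h := ((H.tendsto_mul_sub_pencil_zero hz hk).comp hscale).div_const B
    rw [div_div, mul_comm _ B] at h
    refine h.congr fun N => ?_
    simp only [Function.comp_apply]
    field_simp
  refine ⟨x, y, fun N => z (B * N), hx, ?_, fun N hN => ?_, fun N hN => ⟨fun k hk => ?_, ?_, ?_⟩,
    fun k hk => ?_, ?_, fun k hk => hlim k (hIcc k hk), ?_, fun k hk => ?_⟩
  · exact hPm.listsZeros hPd
      (H.right.strictMonoOn.mono (Icc_subset_Icc_right (Nat.sub_le n 1))) hyP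
  · have hc : 0 ≤ B * N := mul_nonneg hB.le hN
    exact H.listsZeros_pencil hc (hz _ hc) (hpencil N hN) (mops_monic_natDegree _ n).1
  · have hc : 0 < B * N := mul_pos hB hN
    exact ⟨H.left_lt_pencil_zero hc (hz _ hc.le) (hIcc k hk), (hz _ hc.le k (hIcc k hk)).1.2,
      H.lt_succ k hk⟩
  · have hc : 0 < B * N := mul_pos hB hN
    exact H.left_lt_pencil_zero hc (hz _ hc.le) hnn
  · exact hyn ▸ (hz _ (mul_pos hB hN).le n hnn).1.2
  · intro M hM N hN hMN
    exact H.strictMonoOn_pencil_zero hz hk (mul_nonneg hB.le hM) (mul_nonneg hB.le hN)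
      (mul_lt_mul_of_pos_left hMN hB)
  · simpa [hyn] using hlim n hnn
  · have h := hrate n hnn
    rw [hder, hyn] at h
    simpa using h
  · have h := hrate k (hIcc k hk)
    rw [hder, hyP k hk, zero_add, ← mul_assoc] at h
    exact h
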